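/- Let $n,d,k\ge 1$ be integers, $L>0$, $\delta>0$, and let $X_1,\dots,X_n$ be independent random (real or complex) $d\times d$ matrices with common expectation $\mathbb E X_j=X$ and $\|X_j\|\le L$ almost surely for every $j$, where $\|\cdot\|$ is the spectral norm. Set $$Z_{n,k}=\frac1{n^k}\sum_{1\le j_1<\cdots<j_k\le n}X_{j_k}X_{j_{k-1}}\cdots X_{j_1}$$ (an empty sum, i.e. $0$, if $k>n$), and suppose that $$k\le\left(\frac{16\,n}{\log(d/\delta)+\log(ne)}\right)^{1/3}.$$ Then $$\mathbf{Prob}\big[\,\|Z_{n,k}-\mathbb E Z_{n,k}\|>\gamma_k\,\big]\le\delta^k,$$ where $$\gamma_k=2\left(\frac{eL}{k-1}\right)^{k-1}\left(\frac{2L}{\sqrt n}\sqrt{\log\left(\frac{2d\,(ne/(k-1))^{k-1}}{\delta}\right)}+\frac{L(k-1)}{n}\right),$$ and for $k=1$ the powers with exponent $k-1=0$ are read as $1$, so that $\gamma_1=\frac{4L}{\sqrt n}\sqrt{\log(2d/\delta)}$. (For $\delta\ge1$ the claim is trivial, since then $\delta^k\ge 1$; there a square root of a negative number in $\gamma_k$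 may be read as $0$.) -/

import Mathlib

open MeasureTheory ProbabilityTheory
open scoped Matrix.Norms.L2Operator

/-- Random matrices are measured entrywise: the product sigma-algebra on matrices. -/
instance matrixMeasurableSpace {m n α : Type*} [MeasurableSpace α] :
    MeasurableSpace (Matrix m n α) :=
  (MeasurableSpace.pi : MeasurableSpace (m → n → α))

/-- The expectation of a random matrix, taken entry by entry. -/
noncomputable def matrixExpectation {Ω 𝕜 : Type*} [MeasurableSpace Ω] [RCLike 𝕜] {d : ℕ}
    (μ : Measure Ω) (A : Ω → Matrix (Fin d) (Fin d) 𝕜) : Matrix (Fin d) (Fin d) 𝕜 :=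
  Matrix.of fun a b => ∫ ω, A ω a b ∂μ

/-- For a set of indices `s = {j₁ < ⋯ < jₖ}`, the ordered product `X_{jₖ} ⋯ X_{j₁}`
(largest index on the left). -/
def descendingProd {𝕜 : Type*} [RCLike 𝕜] {d n : ℕ}
    (X : Fin n → Matrix (Fin d) (Fin d) 𝕜) (s : Finset (Fin n)) : Matrix (Fin d) (Fin d) 𝕜 :=
  ((s.sort (· ≥ ·)).map X).prod

/-- The degree-`k` term `Z_{n,k} = n⁻ᵏ ∑_{j₁ < ⋯ < jₖ} X_{jₖ} ⋯ X_{j₁}`. -/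
noncomputable def degreeTerm {𝕜 : Type*} [RCLike 𝕜] {d n : ℕ}
    (X : Fin n → Matrix (Fin d) (Fin d) 𝕜) (k : ℕ) : Matrix (Fin d) (Fin d) 𝕜 :=
  ((1 / (n : 𝕜)) ^ k) •
    ∑ s ∈ Finset.powersetCard k (Finset.univ : Finset (Fin n)), descendingProd X s

/-- The deviation level `γₖ`, for `k ≥ 1`. For `k = 1` both powers with exponent `k - 1` are `1`. -/
noncomputable def gammaLevel (n d k : ℕ) (L δ : ℝ) : ℝ :=
  2 * (Real.exp 1 * L / ((k : ℝ) - 1)) ^ (k - 1) *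
    (2 * L / Real.sqrt n *
        Real.sqrt (Real.log (2 * d * (n * Real.exp 1 / ((k : ℝ) - 1)) ^ (k - 1) / δ))
      + L * ((k : ℝ) - 1) / n)

/-! ### Trace inequalities for Hermitian matrices -/

section TraceInequalities

open Matrix
open scoped ComplexOrder

variable {𝕜 ι : Type*} [RCLike 𝕜] [Fintype ι] [DecidableEq ι]

/-! The proof combines Hoeffding's averaging trick for U-statistics with a matrix Hoeffding
inequality proved through even trace moments.

The deviation of `Z_{n,k}` is `n⁻ᵏ` times the sum `T` of the centred products over all `k`-subsets.
Up to scaling, `T` is the average over permutations of `Fin n` of sums over `m = ⌊n/k⌋` disjoint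
blocks of size `k` (`exists_sum_perm_eq_nsmul_sum`). Each block sum has independent centred summands
of norm at most `R = 2Lᵏ`, and by convexity its moment bounds pass to `(m / C(n,k)) ‖T‖`
(`norm_sum_centredProd_pow_le`).

For independent centred Hermitian summands, `E tr S^{2q} / (2q)! ≤ D (mR²/2)^q / q!`, with `D` the
dimension, by induction on the number of summands. Along `H = S + tY`, the functions `h_q(t) = tr
H^{2q} / (2q)!` satisfy `h_{q+1}'' ≤ R² h_q`, because `tr(Y Hⁱ Y Hʲ) ≤ ‖Y‖² tr H^{i+j}` for even `i
+ j`. Comparison with the equality case (`le_hyperbolicSum`) gives a cosh part in `tr S^{2l}` and a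
sinh part in `tr(Y S^{2l+1})`, which has mean zero. Hermitian dilation removes the symmetry
assumption.

Summing the moments against a cosh series gives a Gaussian tail
(`measureReal_lt_le_of_even_moments`). Finally `n^k / C(n,k) ≥ k!` and `n ≤ 2mk` show that `γₖ` is
large enough. -/

theorem pow_mul_pow_add_le {i j : ℕ} (h : Even (i + j)) (x y : ℝ) :
    x ^ i * y ^ j + x ^ j * y ^ i ≤ x ^ (i + j) + y ^ (i + j) := by
  -- The exponents have equal parity, so both differences have the same sign: powers are monotone in
  -- the absolute value (even case) or in the number itself (odd case).
  have key : 0 ≤ (x ^ i - y ^ i) * (x ^ j - y ^ j) := by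
    rcases Nat.even_or_odd i with hi | hi
    · have hj : Even j := by rw [Nat.even_add] at h; exact h.mp hi
      rw [← hi.pow_abs x, ← hi.pow_abs y, ← hj.pow_abs x, ← hj.pow_abs y]
      rcases le_total |x| |y| with hxy | hxy
      · exact mul_nonneg_of_nonpos_of_nonpos
          (sub_nonpos.2 (pow_le_pow_left₀ (abs_nonneg _) hxy _))
          (sub_nonpos.2 (pow_le_pow_left₀ (abs_nonneg _) hxy _))
      · exact mul_nonneg
          (sub_nonneg.2 (pow_le_pow_left₀ (abs_nonneg _) hxy _))
          (sub_nonneg.2 (pow_le_pow_left₀ (abs_nonneg _) hxy _))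
    · have hj : Odd j := by
        rw [← Nat.not_even_iff_odd] at hi ⊢
        rw [Nat.even_add] at h
        tauto
      rcases le_total x y with hxy | hxy
      · exact mul_nonneg_of_nonpos_of_nonpos
          (sub_nonpos.2 (hi.strictMono_pow.monotone hxy))
          (sub_nonpos.2 (hj.strictMono_pow.monotone hxy))
      · exact mul_nonneg
          (sub_nonneg.2 (hi.strictMono_pow.monotone hxy))
          (sub_nonneg.2 (hj.strictMono_pow.monotone hxy))
  rw [pow_add, pow_add]
  nlinarith [key]

theorem trace_mul_diagonal_mul_mul_diagonal (A B : Matrix ι ι 𝕜) (u v : ι → 𝕜) :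
    (A * diagonal u * B * diagonal v).trace = ∑ a, ∑ b, A a b * u b * B b a * v a := by
  simp only [trace, diag_apply, mul_diagonal, Finset.sum_mul,
    mul_apply (M := A * diagonal u) (N := B)]

theorem re_trace_mul_diagonal_pow {Y : Matrix ι ι 𝕜} (hY : Y.IsHermitian) (l : ι → ℝ) (p q : ℕ) :
    RCLike.re (Y * diagonal (fun a => (l a : 𝕜)) ^ p * Y *
      diagonal (fun a => (l a : 𝕜)) ^ q).trace = ∑ a, ∑ b, ‖Y a b‖ ^ 2 * (l b ^ p * l a ^ q) := by
  rw [diagonal_pow, diagonal_pow, trace_mul_diagonal_mul_mul_diagonal, map_sum]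
  refine Finset.sum_congr rfl fun a _ => ?_
  rw [map_sum]
  refine Finset.sum_congr rfl fun b _ => ?_
  have e1 : Y b a = star (Y a b) := (hY.apply b a).symm
  have e2 : Y a b * (l b : 𝕜) ^ p * star (Y a b) * (l a : 𝕜) ^ q
      = ((‖Y a b‖ ^ 2 * (l b ^ p * l a ^ q) : ℝ) : 𝕜) := by
    push_cast
    rw [← RCLike.mul_conj, ← starRingEnd_apply]
    ring
  rw [e1, Pi.pow_apply, Pi.pow_apply, e2, RCLike.ofReal_re]

/-- Symmetric weights allow averaging over the swap of `a` and `b`, which reduces the claim to the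
scalar inequality `pow_mul_pow_add_le`. In the application `l` lists eigenvalues of either sign,
hence the parity condition. -/
theorem sum_mul_pow_mul_pow_le {κ : Type*} [Fintype κ] {w : κ → κ → ℝ} (hw : ∀ a b, 0 ≤ w a b)
    (hs : ∀ a b, w a b = w b a) (l : κ → ℝ) {i j : ℕ} (h : Even (i + j)) :
    ∑ a, ∑ b, w a b * (l b ^ i * l a ^ j) ≤ ∑ a, ∑ b, w a b * (l b ^ 0 * l a ^ (i + j)) := by
  have sw (p q : ℕ) : ∑ a, ∑ b, w a b * (l b ^ p * l a ^ q)
      = ∑ a, ∑ b, w a b * (l a ^ p * l b ^ q) := by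
    rw [Finset.sum_comm]
    refine Finset.sum_congr rfl fun a _ => Finset.sum_congr rfl fun b _ => ?_
    rw [hs]
  have key : ∑ a, ∑ b, w a b * (l b ^ i * l a ^ j) + ∑ a, ∑ b, w a b * (l a ^ i * l b ^ j) ≤
      ∑ a, ∑ b, w a b * (l b ^ 0 * l a ^ (i + j)) +
        ∑ a, ∑ b, w a b * (l a ^ 0 * l b ^ (i + j)) := by
    simp only [← Finset.sum_add_distrib, ← mul_add]
    refine Finset.sum_le_sum fun a _ => Finset.sum_le_sum fun b _ =>
      mul_le_mul_of_nonneg_left ?_ (hw a b)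
    have := pow_mul_pow_add_le h (l a) (l b)
    simp only [pow_zero, one_mul]
    linarith
  rw [← sw, ← sw] at key
  linarith

theorem re_trace_diagonal_le {Y : Matrix ι ι 𝕜} (hY : Y.IsHermitian) (l : ι → ℝ) {i j : ℕ}
    (h : Even (i + j)) :
    RCLike.re (Y * diagonal (fun a => (l a : 𝕜)) ^ i * Y *
        diagonal (fun a => (l a : 𝕜)) ^ j).trace ≤
      RCLike.re (Y * Y * diagonal (fun a => (l a : 𝕜)) ^ (i + j)).trace := by
  have h0 := re_trace_mul_diagonal_pow hY l 0 (i + j)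
  rw [pow_zero, mul_one] at h0
  rw [h0, re_trace_mul_diagonal_pow hY]
  refine sum_mul_pow_mul_pow_le (w := fun a b => ‖Y a b‖ ^ 2) (fun a b => by positivity)
    (fun a b => ?_) l h
  show ‖Y a b‖ ^ 2 = ‖Y b a‖ ^ 2
  rw [← hY.apply b a, norm_star]

/-- Diagonalisation by a trace-preserving star automorphism. -/
theorem Matrix.IsHermitian.exists_conj_diagonal {H : Matrix ι ι 𝕜} (hH : H.IsHermitian) :
    ∃ φ : Matrix ι ι 𝕜 ≃⋆ₐ[𝕜] Matrix ι ι 𝕜, (∀ Z, (φ Z).trace = Z.trace) ∧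
      (∀ Z, ‖φ Z‖ = ‖Z‖) ∧ H = φ (diagonal fun a => (hH.eigenvalues a : 𝕜)) := by
  refine ⟨Unitary.conjStarAlgAut 𝕜 _ hH.eigenvectorUnitary, fun Z => ?_, fun Z => ?_,
    hH.spectral_theorem⟩
  · rw [Unitary.conjStarAlgAut_apply, trace_mul_comm, ← mul_assoc, Unitary.coe_star_mul_self,
      one_mul]
  · rw [Unitary.conjStarAlgAut_apply, ← Unitary.coe_star, CStarRing.norm_mul_coe_unitary,
      CStarRing.norm_coe_unitary_mul]

theorem re_trace_mul_pow_mul_mul_pow_le {H Y : Matrix ι ι 𝕜} (hH : H.IsHermitian)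
    (hY : Y.IsHermitian) {i j : ℕ} (h : Even (i + j)) :
    RCLike.re (Y * H ^ i * Y * H ^ j).trace ≤ RCLike.re (Y * Y * H ^ (i + j)).trace := by
  obtain ⟨φ, hφ, -, e⟩ := hH.exists_conj_diagonal
  obtain ⟨Z, rfl⟩ := EquivLike.surjective φ Y
  have hZ : Z.IsHermitian := by
    apply φ.injective
    exact (map_star φ Z).trans hY
  rw [e]
  simp only [← map_pow, ← map_mul, hφ]
  exact re_trace_diagonal_le hZ _ h

theorem re_trace_conjTranspose_mul_self {κ : Type*} [Fintype κ] (B : Matrix κ κ 𝕜) :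
    RCLike.re (Bᴴ * B).trace = ∑ b, ‖WithLp.toLp 2 (fun a => B a b)‖ ^ 2 := by
  rw [trace, map_sum]
  refine Finset.sum_congr rfl fun b _ => ?_
  rw [EuclideanSpace.norm_sq_eq, diag_apply, mul_apply, map_sum]
  refine Finset.sum_congr rfl fun a _ => ?_
  rw [conjTranspose_apply, RCLike.star_def, RCLike.conj_mul]
  norm_cast

/-- The trace is the sum of the squared column norms, and `Y` acts on each column separately. -/
theorem re_trace_conjTranspose_mul_self_le (Y B : Matrix ι ι 𝕜) :
    RCLike.re ((Y * B)ᴴ * (Y * B)).trace ≤ ‖Y‖ ^ 2 * RCLike.re (Bᴴ * B).trace := by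
  rw [re_trace_conjTranspose_mul_self, re_trace_conjTranspose_mul_self, Finset.mul_sum]
  refine Finset.sum_le_sum fun b _ => ?_
  rw [← mul_pow]
  gcongr
  exact l2_opNorm_mulVec Y (WithLp.toLp 2 fun a => B a b)

theorem re_trace_mul_self_mul_pow_le {H Y : Matrix ι ι 𝕜} (hH : H.IsHermitian)
    (hY : Y.IsHermitian) (p : ℕ) :
    RCLike.re (Y * Y * H ^ (2 * p)).trace ≤ ‖Y‖ ^ 2 * RCLike.re (H ^ (2 * p)).trace := by
  have h := re_trace_conjTranspose_mul_self_le Y (H ^ p)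
  have e : (H ^ p)ᴴ = H ^ p := by rw [conjTranspose_pow, hH.eq]
  rw [conjTranspose_mul, e, hY.eq, mul_assoc, trace_mul_comm, ← mul_assoc Y Y, mul_assoc (Y * Y),
    ← pow_add, ← two_mul] at h
  exact h

theorem re_trace_mul_pow_mul_mul_pow_le_norm {H Y : Matrix ι ι 𝕜} (hH : H.IsHermitian)
    (hY : Y.IsHermitian) {i j p : ℕ} (h : i + j = 2 * p) :
    RCLike.re (Y * H ^ i * Y * H ^ j).trace ≤ ‖Y‖ ^ 2 * RCLike.re (H ^ (2 * p)).trace := by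
  have := re_trace_mul_pow_mul_mul_pow_le hH hY (i := i) (j := j) (h ▸ even_two_mul p)
  rw [h] at this
  exact this.trans (re_trace_mul_self_mul_pow_le hH hY p)

theorem re_trace_pow_two_mul_nonneg {H : Matrix ι ι 𝕜} (hH : H.IsHermitian) (p : ℕ) :
    0 ≤ RCLike.re (H ^ (2 * p)).trace := by
  have e : (H ^ p)ᴴ = H ^ p := by rw [conjTranspose_pow, hH.eq]
  have h := re_trace_conjTranspose_mul_self (H ^ p)
  rw [e, ← pow_add, ← two_mul] at h
  rw [h]
  positivity

/-- The norm is the largest eigenvalue, and its `q`-th power is one of the nonnegative terms of the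
trace. -/
theorem Matrix.PosSemidef.norm_pow_le_re_trace {G : Matrix ι ι 𝕜} (hG : G.PosSemidef) (q : ℕ)
    [Nonempty ι] : ‖G‖ ^ q ≤ RCLike.re (G ^ q).trace := by
  obtain ⟨φ, hφ, hφn, e⟩ := hG.1.exists_conj_diagonal
  have hn : ‖G‖ = ‖fun a => (hG.1.eigenvalues a : 𝕜)‖ := by
    rw [← l2_opNorm_diagonal]
    conv_lhs => rw [e]
    exact hφn _
  have ht : RCLike.re (G ^ q).trace = ∑ a, hG.1.eigenvalues a ^ q := by
    conv_lhs => rw [e]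
    rw [← map_pow, hφ, diagonal_pow, trace_diagonal, map_sum]
    refine Finset.sum_congr rfl fun a _ => ?_
    rw [Pi.pow_apply, ← RCLike.ofReal_pow, RCLike.ofReal_re]
  obtain ⟨a, ha⟩ : ∃ a, ‖fun a => (hG.1.eigenvalues a : 𝕜)‖ = hG.1.eigenvalues a := by
    obtain ⟨a, -, ha⟩ := Finset.exists_max_image Finset.univ (fun a => hG.1.eigenvalues a)
      Finset.univ_nonempty
    refine ⟨a, le_antisymm ?_ ?_⟩
    · refine (pi_norm_le_iff_of_nonneg (hG.eigenvalues_nonneg a)).2 fun b => ?_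
      rw [RCLike.norm_ofReal, abs_of_nonneg (hG.eigenvalues_nonneg b)]
      exact ha b (Finset.mem_univ b)
    · refine le_trans (le_of_eq ?_) (norm_le_pi_norm (fun a => (hG.1.eigenvalues a : 𝕜)) a)
      rw [RCLike.norm_ofReal, abs_of_nonneg (hG.eigenvalues_nonneg a)]
  rw [hn, ht, ha]
  exact Finset.single_le_sum (f := fun a => hG.1.eigenvalues a ^ q)
    (fun b _ => pow_nonneg (hG.eigenvalues_nonneg b) q) (Finset.mem_univ a)

end TraceInequalities

/-! ### A comparison principle for a hierarchy of second-order differential inequalities -/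

section Comparison

open Finset Finset.Nat
open scoped Nat

theorem nonneg_of_hasDerivAt_nonneg {f f' : ℝ → ℝ} (hf : ∀ t, HasDerivAt f (f' t) t)
    (h0 : 0 ≤ f 0) (hf' : ∀ t, 0 ≤ t → 0 ≤ f' t) {t : ℝ} (ht : 0 ≤ t) : 0 ≤ f t := by
  have : MonotoneOn f (Set.Ici 0) := by
    refine monotoneOn_of_deriv_nonneg (convex_Ici 0)
      (fun x _ => (hf x).continuousAt.continuousWithinAt)
      (fun x _ => (hf x).differentiableAt.differentiableWithinAt) fun x hx => ?_
    rw [interior_Ici] at hx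
    rw [(hf x).deriv]
    exact hf' x (le_of_lt hx)
  exact h0.trans (this Set.self_mem_Ici ht ht)

/-- The convolution sum `∑_{j + l = q} cʲ t^{2j+e} / (2j+e)! · u l`. -/
noncomputable def hyperbolicSum (c : ℝ) (e : ℕ) (u : ℕ → ℝ) (q : ℕ) (t : ℝ) : ℝ :=
  ∑ p ∈ antidiagonal q, c ^ p.1 * (t ^ (2 * p.1 + e) / (2 * p.1 + e)!) * u p.2

theorem hasDerivAt_pow_div_factorial (m : ℕ) (t : ℝ) :
    HasDerivAt (fun t : ℝ => t ^ (m + 1) / (m + 1)!) (t ^ m / m !) t := by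
  refine ((hasDerivAt_pow (m + 1) t).div_const ((m + 1)! : ℝ)).congr_deriv ?_
  rw [Nat.factorial_succ]
  push_cast
  have : (m ! : ℝ) ≠ 0 := by positivity
  field_simp

theorem hasDerivAt_hyperbolicSum_succ (c : ℝ) (e : ℕ) (u : ℕ → ℝ) (q : ℕ) (t : ℝ) :
    HasDerivAt (hyperbolicSum c (e + 1) u q) (hyperbolicSum c e u q t) t := by
  unfold hyperbolicSum
  refine HasDerivAt.fun_sum fun p _ => ?_
  exact ((hasDerivAt_pow_div_factorial (2 * p.1 + e) t).const_mul _).mul_const _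

theorem hyperbolicSum_zero_succ (c : ℝ) (u : ℕ → ℝ) (q : ℕ) (t : ℝ) :
    hyperbolicSum c 0 u (q + 1) t = u (q + 1) + c * hyperbolicSum c 2 u q t := by
  simp only [hyperbolicSum, antidiagonal_succ, sum_cons, sum_map, mul_sum]
  congr 1
  · simp
  · refine sum_congr rfl fun p _ => ?_
    simp only [Function.Embedding.prodMap, Function.Embedding.coeFn_mk, Prod.map,
      Function.Embedding.refl_apply, Nat.succ_eq_add_one, mul_add, mul_one, add_zero]
    ring

theorem hasDerivAt_hyperbolicSum_zero_succ (c : ℝ) (u : ℕ → ℝ) (q : ℕ) (t : ℝ) :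
    HasDerivAt (hyperbolicSum c 0 u (q + 1)) (c * hyperbolicSum c 1 u q t) t := by
  have := ((hasDerivAt_hyperbolicSum_succ c 1 u q t).const_mul c).const_add (u (q + 1))
  exact this.congr_of_eventuallyEq (.of_forall fun t => hyperbolicSum_zero_succ c u q t)

theorem hyperbolicSum_zero (c : ℝ) (u : ℕ → ℝ) (t : ℝ) : hyperbolicSum c 0 u 0 t = u 0 := by
  simp [hyperbolicSum]

theorem hyperbolicSum_zero_apply_zero (c : ℝ) (u : ℕ → ℝ) (q : ℕ) :
    hyperbolicSum c 0 u q 0 = u q := by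
  cases q with
  | zero => exact hyperbolicSum_zero c u 0
  | succ q =>
    rw [hyperbolicSum_zero_succ]
    simp [hyperbolicSum]

theorem hyperbolicSum_succ_apply_zero (c : ℝ) (e : ℕ) (u : ℕ → ℝ) (q : ℕ) :
    hyperbolicSum c (e + 1) u q 0 = 0 := by
  simp [hyperbolicSum]

/-- The right-hand side solves `h_{q+1}'' = c h_q` with the same initial values and first
derivatives as `h`. Induction on `q` bounds the second derivative; two integrations from `0` then
bound `h (q + 1)`. -/
theorem le_hyperbolicSum {h g k : ℕ → ℝ → ℝ} {c : ℝ} (hc : 0 ≤ c)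
    (h0 : ∀ t, h 0 t = h 0 0)
    (hh : ∀ q t, HasDerivAt (h (q + 1)) (g q t) t) (hg : ∀ q t, HasDerivAt (g q) (k q t) t)
    (hk : ∀ q t, k q t ≤ c * h q t) (q : ℕ) :
    ∀ t, 0 ≤ t → h (q + 1) t ≤ hyperbolicSum c 0 (fun l => h l 0) (q + 1) t +
      hyperbolicSum c 1 (fun l => g l 0) q t := by
  -- `B` is the sinh part of the bound at level `q`: zero for `q = 0`, and the sum of level `q - 1`
  -- otherwise.
  have step (q : ℕ) (B : ℝ → ℝ)
      (hB : ∀ t, 0 ≤ t → h q t ≤ hyperbolicSum c 0 (fun l => h l 0) q t + B t)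
      (hO : ∀ t, HasDerivAt (hyperbolicSum c 0 (fun l => g l 0) q) (c * B t) t) :
      ∀ t, 0 ≤ t → h (q + 1) t ≤ hyperbolicSum c 0 (fun l => h l 0) (q + 1) t +
      hyperbolicSum c 1 (fun l => g l 0) q t := by
    intro t ht
    rw [← sub_nonneg]
    refine nonneg_of_hasDerivAt_nonneg
      (fun t => ((hasDerivAt_hyperbolicSum_zero_succ c (fun l => h l 0) q t).add
        (hasDerivAt_hyperbolicSum_succ c 0 (fun l => g l 0) q t)).sub (hh q t)) ?_ ?_ ht
    · simp [hyperbolicSum_zero_apply_zero, hyperbolicSum_succ_apply_zero]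
    · intro t ht
      refine nonneg_of_hasDerivAt_nonneg
        (fun t => (((hasDerivAt_hyperbolicSum_succ c 0 (fun l => h l 0) q t).const_mul c).add
        (hO t)).sub (hg q t)) ?_ ?_ ht
      · simp [hyperbolicSum_zero_apply_zero, hyperbolicSum_succ_apply_zero]
      · intro t ht
        have h1 := hk q t
        have h2 := mul_le_mul_of_nonneg_left (hB t ht) hc
        linarith
  induction q with
  | zero =>
    refine step 0 (fun _ => 0) (fun t _ => ?_) (fun t => ?_)
    · rw [hyperbolicSum_zero, h0, add_zero]
    · rw [mul_zero]
      exact (hasDerivAt_const t (g 0 0)).congr_of_eventuallyEq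
        (.of_forall fun t => hyperbolicSum_zero c _ t)
  | succ q ih =>
    exact step (q + 1) _ ih fun t => hasDerivAt_hyperbolicSum_zero_succ c _ q t

end Comparison

/-! ### Derivatives of trace powers along a line -/

section TracePowers

open Matrix
open scoped Nat

variable {𝕜 ι : Type*} [RCLike 𝕜] [Fintype ι] [DecidableEq ι]

theorem hasDerivAt_matrix_pow_apply (S Y : Matrix ι ι 𝕜) (m : ℕ) (t : ℝ) (a b : ι) :
    HasDerivAt (fun t : ℝ => ((S + (t : 𝕜) • Y) ^ m) a b)
      ((∑ i ∈ Finset.range m, (S + (t : 𝕜) • Y) ^ i * Y * (S + (t : 𝕜) • Y) ^ (m - 1 - i)) a b)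
      t := by
  induction m generalizing a b with
  | zero => simpa using hasDerivAt_const t ((1 : Matrix ι ι 𝕜) a b)
  | succ m ih =>
    have h1 (c d : ι) : HasDerivAt (fun t : ℝ => (S + (t : 𝕜) • Y) c d) (Y c d) t := by
      have := ((RCLike.ofRealCLM (K := 𝕜)).hasDerivAt (x := t)).mul_const (Y c d)
      refine ((this.const_add (S c d)).congr_deriv (by simp)).congr_of_eventuallyEq
        (.of_forall fun x => ?_)
      simp [RCLike.real_smul_eq_coe_mul]
    have h2 := HasDerivAt.fun_sum (u := Finset.univ) fun c _ => (ih a c).mul (h1 c b)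
    have e : ∑ i ∈ Finset.range (m + 1),
        (S + (t : 𝕜) • Y) ^ i * Y * (S + (t : 𝕜) • Y) ^ (m + 1 - 1 - i) =
        (∑ i ∈ Finset.range m, (S + (t : 𝕜) • Y) ^ i * Y * (S + (t : 𝕜) • Y) ^ (m - 1 - i)) *
          (S + (t : 𝕜) • Y) + (S + (t : 𝕜) • Y) ^ m * Y := by
      rw [Finset.sum_range_succ, Finset.sum_mul]
      congr 1
      · refine Finset.sum_congr rfl fun i hi => ?_
        rw [Finset.mem_range] at hi
        rw [mul_assoc (_ * Y), ← pow_succ]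
        congr 2
        omega
      · simp
    rw [e]
    simp only [pow_succ, mul_apply, add_apply _ _ a b]
    rw [← Finset.sum_add_distrib]
    exact h2

theorem hasDerivAt_re_trace_mul_pow (Z S Y : Matrix ι ι 𝕜) (m : ℕ) (t : ℝ) :
    HasDerivAt (fun t : ℝ => RCLike.re (Z * (S + (t : 𝕜) • Y) ^ m).trace)
      (∑ i ∈ Finset.range m, RCLike.re
        (Z * (S + (t : 𝕜) • Y) ^ i * Y * (S + (t : 𝕜) • Y) ^ (m - 1 - i)).trace) t := by
  have h := HasDerivAt.fun_sum (u := Finset.univ) fun a _ =>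
    HasDerivAt.fun_sum (u := Finset.univ) fun b _ =>
      (hasDerivAt_matrix_pow_apply S Y m t b a).const_mul (Z a b)
  have h' := (RCLike.reCLM (K := 𝕜)).hasFDerivAt.comp_hasDerivAt t h
  refine h'.congr_deriv ?_
  rw [← map_sum, ← trace_sum]
  simp only [mul_assoc]
  rw [← Finset.mul_sum]
  rfl

theorem hasDerivAt_re_trace_pow (S Y : Matrix ι ι 𝕜) (m : ℕ) (t : ℝ) :
    HasDerivAt (fun t : ℝ => RCLike.re ((S + (t : 𝕜) • Y) ^ m).trace)
      (m * RCLike.re (Y * (S + (t : 𝕜) • Y) ^ (m - 1)).trace) t := by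
  have h := hasDerivAt_re_trace_mul_pow 1 S Y m t
  simp only [one_mul] at h
  refine h.congr_deriv ?_
  rw [← nsmul_eq_mul, ← Finset.card_range m, ← Finset.sum_const, Finset.card_range]
  refine Finset.sum_congr rfl fun i hi => ?_
  rw [Finset.mem_range] at hi
  rw [mul_assoc, trace_mul_comm, mul_assoc, ← pow_add, Nat.sub_add_cancel (by omega)]

/-- The comparison principle on the segment from `S` to `S + Y`, evaluated at `t = 1`. Only the sinh
part is odd in `Y`, so it disappears under expectation. -/
theorem re_trace_add_pow_le {S Y : Matrix ι ι 𝕜} (hS : S.IsHermitian) (hY : Y.IsHermitian)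
    {R : ℝ} (hR : ‖Y‖ ≤ R) (q : ℕ) :
    RCLike.re ((S + Y) ^ (2 * (q + 1))).trace / (2 * (q + 1))! ≤
      hyperbolicSum (R ^ 2) 0 (fun l => RCLike.re (S ^ (2 * l)).trace / (2 * l)!) (q + 1) 1 +
      hyperbolicSum (R ^ 2) 1 (fun l => RCLike.re (Y * S ^ (2 * l + 1)).trace / (2 * l + 1)!)
        q 1 := by
  have hH (t : ℝ) : (S + (t : 𝕜) • Y).IsHermitian := by
    refine hS.add ?_
    rw [IsHermitian, conjTranspose_smul, hY.eq, RCLike.star_def, RCLike.conj_ofReal]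
  have := le_hyperbolicSum (c := R ^ 2)
    (h := fun l t => RCLike.re ((S + (t : 𝕜) • Y) ^ (2 * l)).trace / (2 * l)!)
    (g := fun l t => RCLike.re (Y * (S + (t : 𝕜) • Y) ^ (2 * l + 1)).trace / (2 * l + 1)!)
    (k := fun l t => (∑ i ∈ Finset.range (2 * l + 1), RCLike.re
        (Y * (S + (t : 𝕜) • Y) ^ i * Y * (S + (t : 𝕜) • Y) ^ (2 * l + 1 - 1 - i)).trace) /
          (2 * l + 1)!) (sq_nonneg R) (fun t => by simp) (fun q t => ?_) (fun q t => ?_)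
    (fun q t => ?_) q 1 zero_le_one
  · simpa using this
  · have h := (hasDerivAt_re_trace_pow S Y (2 * (q + 1)) t).div_const ((2 * (q + 1))! : ℝ)
    refine h.congr_deriv ?_
    rw [show 2 * (q + 1) = (2 * q + 1) + 1 by ring, Nat.factorial_succ (2 * q + 1),
      Nat.add_sub_cancel]
    push_cast
    have : ((2 * q + 1)! : ℝ) ≠ 0 := by positivity
    field_simp
  · exact (hasDerivAt_re_trace_mul_pow Y S Y (2 * q + 1) t).div_const _
  · have h : ∑ i ∈ Finset.range (2 * q + 1), RCLike.re
        (Y * (S + (t : 𝕜) • Y) ^ i * Y * (S + (t : 𝕜) • Y) ^ (2 * q + 1 - 1 - i)).trace ≤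
        ∑ i ∈ Finset.range (2 * q + 1), R ^ 2 * RCLike.re ((S + (t : 𝕜) • Y) ^ (2 * q)).trace := by
      refine Finset.sum_le_sum fun i hi => ?_
      rw [Finset.mem_range] at hi
      refine (re_trace_mul_pow_mul_mul_pow_le_norm (p := q) (hH t) hY (by omega)).trans ?_
      have := re_trace_pow_two_mul_nonneg (hH t) q
      gcongr
    rw [Finset.sum_const, Finset.card_range, nsmul_eq_mul] at h
    rw [Nat.factorial_succ, div_le_iff₀ (by positivity)]
    refine h.trans (le_of_eq ?_)
    push_cast
    field_simp

end TracePowers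

/-! ### Hermitian dilation -/

section Dilation

open Matrix
open scoped ComplexOrder

variable {𝕜 ι : Type*} [RCLike 𝕜]

/-- The Hermitian dilation of a square matrix. -/
def hermitianDilation (A : Matrix ι ι 𝕜) : Matrix (ι ⊕ ι) (ι ⊕ ι) 𝕜 :=
  fromBlocks 0 A Aᴴ 0

theorem isHermitian_hermitianDilation (A : Matrix ι ι 𝕜) : (hermitianDilation A).IsHermitian := by
  rw [hermitianDilation, IsHermitian, fromBlocks_conjTranspose]
  simp

theorem hermitianDilation_sum {κ : Type*} (s : Finset κ) (A : κ → Matrix ι ι 𝕜) :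
    hermitianDilation (∑ i ∈ s, A i) = ∑ i ∈ s, hermitianDilation (A i) := by
  induction s using Finset.cons_induction with
  | empty => simp [hermitianDilation]
  | cons a s ha ih =>
    rw [Finset.sum_cons, Finset.sum_cons, ← ih]
    simp [hermitianDilation, fromBlocks_add]

variable [Fintype ι] [DecidableEq ι]

theorem hermitianDilation_pow_two_mul (A : Matrix ι ι 𝕜) (q : ℕ) :
    hermitianDilation A ^ (2 * q) = fromBlocks ((A * Aᴴ) ^ q) 0 0 ((Aᴴ * A) ^ q) := by
  rw [pow_mul, pow_two, hermitianDilation, fromBlocks_multiply]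
  simp [fromBlocks_diagonal_pow]

/-- Both diagonal blocks, powers of `A Aᴴ` and `Aᴴ A`, contribute `‖A‖ ^ (2 * q)`. The resulting
factor 2 offsets the doubled dimension of the dilation. -/
theorem norm_pow_le_re_trace_hermitianDilation [Nonempty ι] (A : Matrix ι ι 𝕜) (q : ℕ) :
    2 * ‖A‖ ^ (2 * q) ≤ RCLike.re (hermitianDilation A ^ (2 * q)).trace := by
  have h1 := (posSemidef_conjTranspose_mul_self A).norm_pow_le_re_trace q
  have h2 := (posSemidef_self_mul_conjTranspose A).norm_pow_le_re_trace q
  have e := l2_opNorm_conjTranspose_mul_self Aᴴ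
  rw [conjTranspose_conjTranspose, l2_opNorm_conjTranspose] at e
  rw [l2_opNorm_conjTranspose_mul_self, ← pow_two, ← pow_mul] at h1
  rw [e, ← pow_two, ← pow_mul] at h2
  rw [hermitianDilation_pow_two_mul, trace, Fintype.sum_sum_type, map_add]
  simp only [trace] at h1 h2
  exact (by linarith : 2 * ‖A‖ ^ (2 * q) ≤ RCLike.re (∑ i, ((A * Aᴴ) ^ q).diag i) +
    RCLike.re (∑ i, ((Aᴴ * A) ^ q).diag i))

theorem norm_hermitianDilation_le (A : Matrix ι ι 𝕜) : ‖hermitianDilation A‖ ≤ ‖A‖ := by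
  rw [l2_opNorm_def]
  refine ContinuousLinearMap.opNorm_le_bound _ (norm_nonneg _) fun x => ?_
  have h1 := l2_opNorm_mulVec A (WithLp.toLp 2 fun i => x (Sum.inr i))
  have h2 := l2_opNorm_mulVec Aᴴ (WithLp.toLp 2 fun i => x (Sum.inl i))
  rw [l2_opNorm_conjTranspose] at h2
  refine le_of_sq_le_sq ?_ (by positivity)
  have e (y : EuclideanSpace 𝕜 (ι ⊕ ι)) : ‖y‖ ^ 2 = ‖WithLp.toLp 2 fun i => y (Sum.inl i)‖ ^ 2 +
      ‖WithLp.toLp 2 fun i => y (Sum.inr i)‖ ^ 2 := by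
    simp only [EuclideanSpace.norm_sq_eq, Fintype.sum_sum_type]
  rw [mul_pow, e, e, mul_add, ← mul_pow, ← mul_pow, add_comm]
  have e1 : (fun i => (toEuclideanLin (hermitianDilation A) x) (Sum.inl i)) =
      A *ᵥ fun i => x (Sum.inr i) := by
    ext i
    simp [toEuclideanLin, toLpLin_apply, hermitianDilation, fromBlocks_mulVec, Function.comp_def]
  have e2 : (fun i => (toEuclideanLin (hermitianDilation A) x) (Sum.inr i)) =
      Aᴴ *ᵥ fun i => x (Sum.inl i) := by
    ext i
    simp [toEuclideanLin, toLpLin_apply, hermitianDilation, fromBlocks_mulVec, Function.comp_def]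
  refine add_le_add ?_ ?_
  · refine pow_le_pow_left₀ (norm_nonneg _) (le_of_eq_of_le ?_ h2) 2
    exact congrArg (fun v => ‖WithLp.toLp 2 v‖) e2
  · refine pow_le_pow_left₀ (norm_nonneg _) (le_of_eq_of_le ?_ h1) 2
    exact congrArg (fun v => ‖WithLp.toLp 2 v‖) e1

end Dilation

/-! ### Measurability, integrability and the norm of an expectation -/

section Measurability

variable {𝕜 ι : Type*} [RCLike 𝕜]

theorem continuous_hermitianDilation :
    Continuous (hermitianDilation : Matrix ι ι 𝕜 → Matrix (ι ⊕ ι) (ι ⊕ ι) 𝕜) := by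
  unfold hermitianDilation
  fun_prop

theorem measurable_matrix_apply (a b : ι) : Measurable fun A : Matrix ι ι 𝕜 => A a b :=
  (measurable_pi_apply b).comp (measurable_pi_apply a)

variable [Fintype ι] [DecidableEq ι]

instance : BorelSpace (Matrix ι ι 𝕜) := inferInstanceAs (BorelSpace (ι → ι → 𝕜))

instance : SecondCountableTopology (Matrix ι ι 𝕜) :=
  inferInstanceAs (SecondCountableTopology (ι → ι → 𝕜))

theorem norm_matrix_apply_le (A : Matrix ι ι 𝕜) (a b : ι) : ‖A a b‖ ≤ ‖A‖ := by
  have h := Matrix.l2_opNorm_mulVec A (EuclideanSpace.single b 1)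
  rw [PiLp.norm_single, norm_one, mul_one] at h
  refine le_trans ?_ h
  refine le_trans (le_of_eq ?_) (PiLp.norm_apply_le _ a)
  simp

variable {Ω : Type*} [MeasurableSpace Ω] {μ : Measure Ω} [IsProbabilityMeasure μ]

theorem integrable_matrix_apply {A : Ω → Matrix ι ι 𝕜} (hA : Measurable A) {C : ℝ}
    (hC : ∀ ω, ‖A ω‖ ≤ C) (a b : ι) : Integrable (fun ω => A ω a b) μ :=
  .of_bound ((measurable_matrix_apply a b).comp hA).aestronglyMeasurable C
    (.of_forall fun ω => (norm_matrix_apply_le (A ω) a b).trans (hC ω))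

theorem norm_matrixExpectation_le {d : ℕ} {A : Ω → Matrix (Fin d) (Fin d) 𝕜} (hA : Measurable A)
    {C : ℝ} (hC : ∀ ω, ‖A ω‖ ≤ C) (hC0 : 0 ≤ C) : ‖matrixExpectation μ A‖ ≤ C := by
  rw [Matrix.l2_opNorm_def]
  refine ContinuousLinearMap.opNorm_le_bound _ hC0 fun x => ?_
  -- Applied to a fixed vector, the entrywise expectation becomes a Bochner integral, so the norm
  -- can be moved inside.
  have e : Matrix.toEuclideanLin (matrixExpectation μ A) x
      = ∫ ω, Matrix.toEuclideanLin (A ω) x ∂μ := by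
    ext a
    rw [eval_integral_piLp]
    · simp only [Matrix.toEuclideanLin, Matrix.toLpLin_apply, Matrix.mulVec, dotProduct]
      rw [integral_finsetSum]
      · simp only [integral_mul_const]
        rfl
      · exact fun b _ => (integrable_matrix_apply hA hC a b).mul_const _
    · intro a
      simp only [Matrix.toEuclideanLin, Matrix.toLpLin_apply, Matrix.mulVec, dotProduct]
      exact integrable_finsetSum _ fun b _ => (integrable_matrix_apply hA hC a b).mul_const _
  refine le_of_eq_of_le (congrArg norm e) ?_
  refine (norm_integral_le_of_norm_le_const (C := C * ‖x‖) (.of_forall fun ω => ?_)).trans ?_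
  · exact (Matrix.l2_opNorm_mulVec (A ω) x).trans
      (mul_le_mul_of_nonneg_right (hC ω) (norm_nonneg x))
  · simp

end Measurability

/-! ### Subgaussian even moments of sums of independent matrices -/

section TraceMoments

open Matrix Finset
open scoped Nat

variable {Ω : Type*} [MeasurableSpace Ω] {μ : Measure Ω}

theorem sum_antidiagonal_pow_div_factorial (x y : ℝ) (q : ℕ) :
    ∑ p ∈ antidiagonal q, x ^ p.1 / p.1 ! * (y ^ p.2 / p.2 !) = (x + y) ^ q / q ! := by
  rw [(Commute.all x y).add_pow', sum_div]
  refine sum_congr rfl fun p hp => ?_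
  rw [HasAntidiagonal.mem_antidiagonal] at hp
  have := Nat.choose_mul_factorial_mul_factorial (show p.1 ≤ q by omega)
  rw [show q - p.1 = p.2 by omega] at this
  rw [← this, nsmul_eq_mul]
  push_cast
  have h : (q.choose p.1 : ℝ) ≠ 0 := by
    exact_mod_cast (Nat.choose_pos (by omega)).ne'
  field_simp

/-- Since `2ʲ j! ≤ (2j)!`, the cosh coefficients are dominated by those of `exp (R² / 2)`;
convolving exponential series adds their exponents. -/
theorem hyperbolicSum_one_le {R D y : ℝ} {u : ℕ → ℝ} (hy : 0 ≤ y) (hD : 0 ≤ D)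
    (hu : ∀ l, u l ≤ D * (y ^ l / l !)) (q : ℕ) :
    hyperbolicSum (R ^ 2) 0 u q 1 ≤ D * ((R ^ 2 / 2 + y) ^ q / q !) := by
  rw [← sum_antidiagonal_pow_div_factorial, mul_sum, hyperbolicSum]
  refine sum_le_sum fun p _ => ?_
  have h1 : (2 ^ p.1 * p.1 ! : ℝ) ≤ (2 * p.1)! := by
    exact_mod_cast Nat.two_pow_mul_factorial_le_factorial_two_mul p.1
  have h2 : (R ^ 2) ^ p.1 * (1 ^ (2 * p.1 + 0) / (2 * p.1 + 0)!) ≤ (R ^ 2 / 2) ^ p.1 / p.1 ! := by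
    rw [one_pow, add_zero, mul_one_div, div_pow, div_div]
    gcongr
  calc _ ≤ (R ^ 2) ^ p.1 * (1 ^ (2 * p.1 + 0) / (2 * p.1 + 0)!) * (D * (y ^ p.2 / p.2 !)) :=
        mul_le_mul_of_nonneg_left (hu _) (by positivity)
    _ ≤ (R ^ 2 / 2) ^ p.1 / p.1 ! * (D * (y ^ p.2 / p.2 !)) := by gcongr
    _ = _ := by ring

theorem integral_hyperbolicSum (c : ℝ) (e : ℕ) {u : ℕ → Ω → ℝ} (hu : ∀ l, Integrable (u l) μ)
    (q : ℕ) (t : ℝ) : Integrable (fun ω => hyperbolicSum c e (fun l => u l ω) q t) μ ∧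
      ∫ ω, hyperbolicSum c e (fun l => u l ω) q t ∂μ =
        hyperbolicSum c e (fun l => ∫ ω, u l ω ∂μ) q t := by
  unfold hyperbolicSum
  refine ⟨integrable_finsetSum _ fun p _ => (hu _).const_mul _, ?_⟩
  rw [integral_finsetSum _ fun p _ => (hu _).const_mul _]
  simp only [integral_const_mul]

variable {𝕜 ι : Type*} [RCLike 𝕜] [Fintype ι] [DecidableEq ι] [IsProbabilityMeasure μ]

theorem integrable_re_trace {A : Ω → Matrix ι ι 𝕜} (hA : Measurable A) {C : ℝ}
    (hC : ∀ ω, ‖A ω‖ ≤ C) : Integrable (fun ω => RCLike.re (A ω).trace) μ :=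
  (integrable_finsetSum univ fun a _ => integrable_matrix_apply hA hC a a).re

theorem norm_matrix_pow_le [Nonempty ι] {A : Matrix ι ι 𝕜} {C : ℝ} (hC : ‖A‖ ≤ C) (p : ℕ) :
    ‖A ^ p‖ ≤ C ^ p :=
  (norm_pow_le A p).trans (pow_le_pow_left₀ (norm_nonneg A) hC p)

theorem integral_re_trace_mul_eq_zero {Y B : Ω → Matrix ι ι 𝕜} (hY : Measurable Y)
    (hB : Measurable B) (hYB : IndepFun Y B μ) {R C : ℝ} (hR : ∀ ω, ‖Y ω‖ ≤ R)
    (hC : ∀ ω, ‖B ω‖ ≤ C) (h0 : ∀ a b, ∫ ω, Y ω a b ∂μ = 0) :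
    ∫ ω, RCLike.re (Y ω * B ω).trace ∂μ = 0 := by
  have hind (a b c d : ι) : IndepFun (fun ω => Y ω a b) (fun ω => B ω c d) μ :=
    hYB.comp (measurable_matrix_apply a b) (measurable_matrix_apply c d)
  have hint (a b c d : ι) : Integrable (fun ω => Y ω a b * B ω c d) μ :=
    (hind a b c d).integrable_mul (integrable_matrix_apply hY hR a b)
      (integrable_matrix_apply hB hC c d)
  have hzero (a b c d : ι) : ∫ ω, Y ω a b * B ω c d ∂μ = 0 := by
    rw [(hind a b c d).integral_fun_mul_eq_mul_integral
      (integrable_matrix_apply hY hR a b).aestronglyMeasurable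
      (integrable_matrix_apply hB hC c d).aestronglyMeasurable, h0, zero_mul]
  have e (ω : Ω) : (Y ω * B ω).trace = ∑ a, ∑ b, Y ω a b * B ω b a := by
    simp [trace, mul_apply]
  simp only [e]
  rw [integral_re (integrable_finsetSum _ fun a _ => integrable_finsetSum _ fun b _ => hint a b b a),
    integral_finsetSum _ fun a _ => integrable_finsetSum _ fun b _ => hint a b b a]
  simp only [integral_finsetSum _ fun b _ => hint _ b b _, hzero, sum_const_zero, map_zero]

/-- The even trace moments of a sum of independent centred bounded Hermitian matrices are
subgaussian. -/
theorem integral_re_trace_sum_pow_le [Nonempty ι] {Y : ℕ → Ω → Matrix ι ι 𝕜} {R : ℝ} {N : ℕ}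
    (hmeas : ∀ i, Measurable (Y i)) (hherm : ∀ i ω, (Y i ω).IsHermitian)
    (hR : ∀ i ω, ‖Y i ω‖ ≤ R) (h0 : ∀ i a b, ∫ ω, Y i ω a b ∂μ = 0)
    (hind : ∀ m < N, IndepFun (Y m) (fun ω => ∑ i ∈ range m, Y i ω) μ) {m : ℕ} (hm : m ≤ N)
    (q : ℕ) :
    ∫ ω, RCLike.re ((∑ i ∈ range m, Y i ω) ^ (2 * q)).trace / (2 * q)! ∂μ ≤
      Fintype.card ι * ((m * (R ^ 2 / 2)) ^ q / q !) := by
  have hS (m : ℕ) : Measurable fun ω => ∑ i ∈ range m, Y i ω :=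
    Finset.measurable_sum _ fun i _ => hmeas i
  have hSn (m : ℕ) (ω : Ω) : ‖∑ i ∈ range m, Y i ω‖ ≤ m * R := by
    refine (norm_sum_le_of_le _ fun i _ => hR i ω).trans ?_
    simp
  have hSp (m p : ℕ) : Measurable fun ω => (∑ i ∈ range m, Y i ω) ^ p := (hS m).pow_const p
  have hSh (m : ℕ) (ω : Ω) : (∑ i ∈ range m, Y i ω).IsHermitian :=
    isSelfAdjoint_sum _ fun i _ => hherm i ω
  induction m generalizing q with
  | zero =>
    cases q with
    | zero => simp
    | succ q => simp
  | succ m ih =>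
    have ih := ih (by omega)
    cases q with
    | zero => simp
    | succ q =>
      set S : Ω → Matrix ι ι 𝕜 := fun ω => ∑ i ∈ range m, Y i ω with hSdef
      have i1 := integral_hyperbolicSum (μ := μ) (R ^ 2) 0
        (u := fun l ω => RCLike.re (S ω ^ (2 * l)).trace / (2 * l)!)
        (fun l => (integrable_re_trace (hSp m (2 * l))
          fun ω => norm_matrix_pow_le (hSn m ω) _).div_const _) (q + 1) 1
      have hYS (p : ℕ) : ∀ ω, ‖Y m ω * S ω ^ p‖ ≤ R * (m * R) ^ p := fun ω =>
        (norm_mul_le _ _).trans (mul_le_mul (hR m ω) (norm_matrix_pow_le (hSn m ω) p)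
          (norm_nonneg _) ((norm_nonneg _).trans (hR m ω)))
      have i2 := integral_hyperbolicSum (μ := μ) (R ^ 2) 1
        (u := fun l ω => RCLike.re (Y m ω * S ω ^ (2 * l + 1)).trace / (2 * l + 1)!)
        (fun l => (integrable_re_trace ((hmeas m).mul (hSp m (2 * l + 1)))
          (hYS (2 * l + 1))).div_const _) q 1
      -- The new summand is centred and independent of the partial sum, so the whole sinh part
      -- integrates to zero.
      have z (l : ℕ) : ∫ ω, RCLike.re (Y m ω * S ω ^ (2 * l + 1)).trace / (2 * l + 1)! ∂μ = 0 := by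
        rw [integral_div, integral_re_trace_mul_eq_zero (hmeas m) (hSp m (2 * l + 1))
          ((hind m (by omega)).comp measurable_id (measurable_id.pow_const (2 * l + 1))) (hR m)
          (fun ω => norm_matrix_pow_le (hSn m ω) _) (h0 m), zero_div]
      have z' : hyperbolicSum (R ^ 2) 1 (fun _ => 0) q 1 = 0 := by simp [hyperbolicSum]
      simp only [z, z'] at i2
      calc _ ≤ ∫ ω, (hyperbolicSum (R ^ 2) 0
              (fun l => RCLike.re (S ω ^ (2 * l)).trace / (2 * l)!) (q + 1) 1 +
            hyperbolicSum (R ^ 2) 1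
              (fun l => RCLike.re (Y m ω * S ω ^ (2 * l + 1)).trace / (2 * l + 1)!) q 1) ∂μ := by
            refine integral_mono ((integrable_re_trace (hSp (m + 1) _)
              fun ω => norm_matrix_pow_le (hSn (m + 1) ω) _).div_const _) (i1.1.add i2.1)
              fun ω => ?_
            simp only [sum_range_succ]
            exact re_trace_add_pow_le (hSh m ω) (hherm m ω) (hR m ω) q
        _ = hyperbolicSum (R ^ 2) 0
              (fun l => ∫ ω, RCLike.re (S ω ^ (2 * l)).trace / (2 * l)! ∂μ) (q + 1) 1 := by
            rw [integral_add i1.1 i2.1, i1.2, i2.2, add_zero]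
        _ ≤ Fintype.card ι * ((R ^ 2 / 2 + m * (R ^ 2 / 2)) ^ (q + 1) / (q + 1)!) :=
            hyperbolicSum_one_le (by positivity) (by positivity) ih _
        _ = _ := by push_cast; ring

/-- The even moments of the norm of a sum of independent centred bounded matrices are
subgaussian. -/
theorem integral_norm_sum_pow_le [Nonempty ι] {Y : ℕ → Ω → Matrix ι ι 𝕜} {R : ℝ} {m : ℕ}
    (hmeas : ∀ i, Measurable (Y i)) (hR : ∀ i ω, ‖Y i ω‖ ≤ R)
    (h0 : ∀ i a b, ∫ ω, Y i ω a b ∂μ = 0)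
    (hind : ∀ l < m, IndepFun (Y l) (fun ω => ∑ i ∈ range l, Y i ω) μ) (q : ℕ) :
    ∫ ω, ‖∑ i ∈ range m, Y i ω‖ ^ (2 * q) / (2 * q)! ∂μ ≤
      Fintype.card ι * ((m * (R ^ 2 / 2)) ^ q / q !) := by
  have hdil : Measurable (hermitianDilation : Matrix ι ι 𝕜 → Matrix (ι ⊕ ι) (ι ⊕ ι) 𝕜) :=
    continuous_hermitianDilation.measurable
  have hSn (ω : Ω) : ‖∑ i ∈ range m, Y i ω‖ ≤ m * R := by
    refine (norm_sum_le_of_le _ fun i _ => hR i ω).trans ?_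
    simp
  have hS : Measurable fun ω => ∑ i ∈ range m, Y i ω :=
    Finset.measurable_sum _ fun i _ => hmeas i
  have h := integral_re_trace_sum_pow_le (μ := μ) (Y := fun i ω => hermitianDilation (Y i ω))
    (R := R) (N := m) (fun i => hdil.comp (hmeas i))
    (fun i ω => isHermitian_hermitianDilation _)
    (fun i ω => (norm_hermitianDilation_le _).trans (hR i ω))
    (fun i a b => ?_) (fun l hl => ?_) le_rfl q
  · simp only [← hermitianDilation_sum] at h
    have h2 : 2 * ∫ ω, ‖∑ i ∈ range m, Y i ω‖ ^ (2 * q) / (2 * q)! ∂μ ≤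
        ∫ ω, RCLike.re (hermitianDilation (∑ i ∈ range m, Y i ω) ^ (2 * q)).trace /
          (2 * q)! ∂μ := by
      rw [← integral_const_mul]
      refine integral_mono_of_nonneg (.of_forall fun ω => by positivity)
        ((integrable_re_trace ((hdil.comp hS).pow_const _) fun ω => norm_matrix_pow_le
          ((norm_hermitianDilation_le _).trans (hSn ω)) _).div_const _) (.of_forall fun ω => ?_)
      simp only
      rw [← mul_div_assoc]
      gcongr
      exact norm_pow_le_re_trace_hermitianDilation _ q
    rw [Fintype.card_sum] at h
    push_cast at h
    linarith
  · rcases a with a | a <;> rcases b with b | b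
    · simp [hermitianDilation]
    · simpa [hermitianDilation] using h0 i a b
    · have : ∫ ω, (starRingEnd 𝕜) (Y i ω b a) ∂μ = 0 := by rw [integral_conj, h0, map_zero]
      simpa [hermitianDilation] using this
    · simp [hermitianDilation]
  · simp only [← hermitianDilation_sum]
    exact (hind l hl).comp hdil hdil

end TraceMoments

/-! ### From even moments to a Gaussian tail -/

section Tail

open scoped Nat

variable {Ω : Type*} [MeasurableSpace Ω] {μ : Measure Ω} [IsProbabilityMeasure μ]

theorem measureReal_lt_le_of_even_moments {W : Ω → ℝ} (hW : ∀ ω, 0 ≤ W ω) {D y w : ℝ}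
    (hint : ∀ q : ℕ, Integrable (fun ω => W ω ^ (2 * q)) μ)
    (hmom : ∀ q : ℕ, ∫ ω, W ω ^ (2 * q) / (2 * q)! ∂μ ≤ D * (y ^ q / q !))
    (hy : 0 < y) (hw : 0 ≤ w) :
    μ.real {ω | w < W ω} ≤ 2 * D * Real.exp (-(w ^ 2 / (4 * y))) := by
  set P := μ.real {ω | w < W ω}
  -- This value minimises `θ² y - θ w`, the exponent of the Chernoff bound.
  set θ := w / (2 * y)
  have hterm (q : ℕ) : P * ((θ * w) ^ (2 * q) / (2 * q)!) ≤ D * ((θ ^ 2 * y) ^ q / q !) := by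
    have h1 : w ^ (2 * q) * P ≤ ∫ ω, W ω ^ (2 * q) ∂μ := by
      refine le_trans ?_ (mul_meas_ge_le_integral_of_nonneg
        (.of_forall fun ω => pow_nonneg (hW ω) (2 * q)) (hint q) (w ^ (2 * q)))
      refine mul_le_mul_of_nonneg_left (measureReal_mono fun ω hω => ?_) (by positivity)
      exact pow_le_pow_left₀ hw (le_of_lt hω) _
    have h2 := hmom q
    rw [integral_div] at h2
    calc P * ((θ * w) ^ (2 * q) / (2 * q)!)
        = θ ^ (2 * q) * (w ^ (2 * q) * P / (2 * q)!) := by rw [mul_pow]; ring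
      _ ≤ θ ^ (2 * q) * ((∫ ω, W ω ^ (2 * q) ∂μ) / (2 * q)!) := by gcongr
      _ ≤ θ ^ (2 * q) * (D * (y ^ q / q !)) := by gcongr
      _ = _ := by rw [mul_pow, ← pow_mul]; ring
  have hs : HasSum (fun q : ℕ => (θ ^ 2 * y) ^ q / q !) (Real.exp (θ ^ 2 * y)) := by
    rw [Real.exp_eq_exp_ℝ]
    exact NormedSpace.expSeries_div_hasSum_exp _
  -- Summing Markov's inequality over all even moments yields `P cosh(θw) ≤ D exp(θ² y)`.
  have key := hasSum_le hterm ((Real.hasSum_cosh (θ * w)).mul_left P) (hs.mul_left D)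
  have e1 : θ * w = 2 * (w ^ 2 / (4 * y)) := by
    simp only [θ]; field_simp; norm_num
  have e2 : θ ^ 2 * y = w ^ 2 / (4 * y) := by
    simp only [θ]; field_simp; norm_num
  rw [e1, e2] at key
  set z := w ^ 2 / (4 * y)
  have hP : 0 ≤ P := measureReal_nonneg
  have h3 : Real.exp (2 * z) / 2 ≤ Real.cosh (2 * z) := by
    rw [Real.cosh_eq]
    have := Real.exp_pos (-(2 * z))
    linarith
  have h4 : P * (Real.exp (2 * z) / 2) ≤ D * Real.exp z :=
    (mul_le_mul_of_nonneg_left h3 hP).trans key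
  have h5 : P * Real.exp z ≤ 2 * D := by
    have : Real.exp (2 * z) = Real.exp z * Real.exp z := by rw [← Real.exp_add, two_mul]
    rw [this] at h4
    have hz := Real.exp_pos z
    refine le_of_mul_le_mul_right ?_ hz
    linarith
  rw [Real.exp_neg, ← div_eq_mul_inv, le_div_iff₀ (Real.exp_pos z)]
  exact h5

end Tail

/-! ### Averages over permutations and disjoint blocks -/

section PermutationAverage

open Finset
open scoped Nat

theorem exists_perm_map_eq {α : Type*} [Fintype α] [DecidableEq α] {s t : Finset α}
    (h : #s = #t) : ∃ σ : Equiv.Perm α, s.map σ.toEmbedding = t := by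
  refine ⟨(Finset.equivOfCardEq h).extendSubtype, ?_⟩
  refine Finset.eq_of_subset_of_card_le (fun a ha => ?_) (by simp [h])
  rw [mem_map] at ha
  obtain ⟨b, hb, rfl⟩ := ha
  exact Equiv.extendSubtype_mem (Finset.equivOfCardEq h) b hb

/-- If `τ` carries `s` to `t` and `ρ` carries `B` to `C`, then `σ ↦ τ σ ρ⁻¹` is a bijection between
the two sets of permutations. -/
theorem card_perm_map_eq {α : Type*} [Fintype α] [DecidableEq α] {B C s t : Finset α}
    (hBC : #B = #C) (hst : #s = #t) :
    #{σ : Equiv.Perm α | B.map σ.toEmbedding = s} =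
      #{σ : Equiv.Perm α | C.map σ.toEmbedding = t} := by
  obtain ⟨τ, rfl⟩ := exists_perm_map_eq hst
  obtain ⟨ρ, rfl⟩ := exists_perm_map_eq hBC
  refine card_equiv ((Equiv.mulLeft τ).trans (Equiv.mulRight ρ⁻¹)) fun σ => ?_
  simp only [mem_filter, mem_univ, true_and, Equiv.trans_apply, Equiv.coe_mulLeft,
    Equiv.coe_mulRight]
  rw [map_map, show ρ.toEmbedding.trans (τ * σ * ρ⁻¹).toEmbedding =
    σ.toEmbedding.trans τ.toEmbedding by ext; simp, ← map_map]
  exact (map_injective τ.toEmbedding).eq_iff.symm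

theorem sum_perm_map_eq_nsmul {α V : Type*} [Fintype α] [DecidableEq α] [AddCommMonoid V]
    (F : Finset α → V) {B C : Finset α} (hBC : #B = #C) :
    ∑ σ : Equiv.Perm α, F (B.map σ.toEmbedding) =
      #{σ : Equiv.Perm α | C.map σ.toEmbedding = C} •
        ∑ s ∈ powersetCard #C (univ : Finset α), F s := by
  rw [smul_sum, ← sum_fiberwise_of_maps_to (s := univ) (t := powersetCard #C univ)
    (g := fun σ : Equiv.Perm α => B.map σ.toEmbedding) (fun σ _ => by simp [hBC])]
  refine sum_congr rfl fun s hs => ?_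
  rw [mem_powersetCard] at hs
  rw [card_perm_map_eq hBC.symm hs.2.symm, ← sum_const]
  refine sum_congr rfl fun σ hσ => ?_
  rw [(mem_filter.1 hσ).2]

/-- Averaging over the images of a fixed `k`-subset under all permutations is averaging over all
`k`-subsets. -/
theorem exists_sum_perm_eq_nsmul_sum {α V : Type*} [Fintype α] [DecidableEq α] [AddCommMonoid V]
    {k : ℕ} (hk : k ≤ Fintype.card α) :
    ∃ c : ℕ, c * (Fintype.card α).choose k = (Fintype.card α)! ∧
      ∀ (F : Finset α → V) (B : Finset α), #B = k →
        ∑ σ : Equiv.Perm α, F (B.map σ.toEmbedding) =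
          c • ∑ s ∈ powersetCard k (univ : Finset α), F s := by
  obtain ⟨C, -, rfl⟩ := exists_subset_card_eq (s := (univ : Finset α)) hk
  refine ⟨_, ?_, fun F B hB => sum_perm_map_eq_nsmul F hB⟩
  have := sum_perm_map_eq_nsmul (fun _ => 1) (rfl : #C = #C)
  simp only [sum_const, card_univ, Fintype.card_perm, card_powersetCard, smul_eq_mul,
    mul_one] at this
  exact this.symm

theorem exists_disjoint_blocks {n k : ℕ} (hk : 0 < k) (hkn : k ≤ n) :
    ∃ B : ℕ → Finset (Fin n), (∀ i, #(B i) = k) ∧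
      ∀ i < n / k, ∀ j < n / k, i ≠ j → Disjoint (B i) (B j) := by
  set m := n / k
  have hm : 0 < m := Nat.div_pos hkn hk
  have hmk : m * k ≤ n := Nat.div_mul_le_self n k
  -- Blocks are consecutive intervals of length `k`; reducing `i` modulo `m` keeps block `i` inside
  -- `Fin n` for every natural `i`.
  have hlt (i : ℕ) : ∀ a ∈ Ico (i % m * k) (i % m * k + k), a < n := by
    intro a ha
    have h1 : i % m + 1 ≤ m := Nat.mod_lt i hm
    have h2 := Nat.mul_le_mul_right k h1
    rw [mem_Ico] at ha
    linarith
  refine ⟨fun i => attachFin _ (hlt i), fun i => by simp, fun i hi j hj hij => ?_⟩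
  rw [disjoint_left]
  intro a ha hb
  rw [mem_attachFin, mem_Ico, Nat.mod_eq_of_lt ‹_›] at ha hb
  rcases lt_or_gt_of_ne hij with h | h
  · have := Nat.mul_le_mul_right k (show i + 1 ≤ j from h)
    linarith
  · have := Nat.mul_le_mul_right k (show j + 1 ≤ i from h)
    linarith

end PermutationAverage

/-! ### Centred ordered products over index sets -/

section DescendingProducts

open Finset

variable {𝕜 : Type*} [RCLike 𝕜] {d n : ℕ}

theorem measurable_descendingProd (s : Finset (Fin n)) :
    Measurable fun X : Fin n → Matrix (Fin d) (Fin d) 𝕜 => descendingProd X s := by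
  unfold descendingProd
  induction s.sort (· ≥ ·) with
  | nil => exact measurable_const
  | cons a l ih => exact (measurable_pi_apply a).mul ih

theorem descendingProd_congr {X Y : Fin n → Matrix (Fin d) (Fin d) 𝕜} {s : Finset (Fin n)}
    (h : ∀ j ∈ s, X j = Y j) : descendingProd X s = descendingProd Y s := by
  unfold descendingProd
  rw [List.map_congr_left fun j hj => h j (by simpa using hj)]

theorem norm_descendingProd_le [Nonempty (Fin d)] {X : Fin n → Matrix (Fin d) (Fin d) 𝕜} {L : ℝ}
    (hX : ∀ j, ‖X j‖ ≤ L) (s : Finset (Fin n)) : ‖descendingProd X s‖ ≤ L ^ #s := by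
  rw [← Finset.length_sort (· ≥ ·) (s := s)]
  unfold descendingProd
  induction s.sort (· ≥ ·) with
  | nil => simp
  | cons a l ih =>
    rw [List.map_cons, List.prod_cons, List.length_cons, pow_succ']
    exact (norm_mul_le _ _).trans
      (mul_le_mul (hX a) ih (norm_nonneg _) ((norm_nonneg _).trans (hX a)))

variable {Ω : Type*} [MeasurableSpace Ω] {μ : Measure Ω}

/-- Functions of a family of independent variables that read disjoint sets of coordinates are
independent. -/
theorem ProbabilityTheory.iIndepFun.indepFun_of_dependsOn {κ E β γ : Type*} [MeasurableSpace E]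
    [Zero E] [MeasurableSpace β] [MeasurableSpace γ] [DecidableEq κ] {X : κ → Ω → E}
    (hX : iIndepFun X μ) (hmeas : ∀ j, Measurable (X j)) {S T : Finset κ} (hST : Disjoint S T)
    {f : (κ → E) → β} {g : (κ → E) → γ} (hf : Measurable f) (hg : Measurable g)
    (hfS : DependsOn f (S : Set κ)) (hgT : DependsOn g (T : Set κ)) :
    IndepFun (fun ω => f fun j => X j ω) (fun ω => g fun j => X j ω) μ := by
  -- Extending by zero off `U` turns a function that reads only coordinates in `U` into a function
  -- of the restricted tuple.
  have hext (U : Finset κ) :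
      Measurable fun (x : U → E) (j : κ) => if h : j ∈ U then x ⟨j, h⟩ else 0 := by
    refine measurable_pi_lambda _ fun j => ?_
    by_cases h : j ∈ U
    · simpa [h] using measurable_pi_apply _
    · simp [h]
  have h := (hX.indepFun_finset S T hST hmeas).comp (hf.comp (hext S)) (hg.comp (hext T))
  convert h using 1
  · ext ω
    exact hfS fun j hj => by simp [show j ∈ S from hj]
  · ext ω
    exact hgT fun j hj => by simp [show j ∈ T from hj]

/-- The product over `s` minus its expectation. -/
noncomputable def centredProd (μ : Measure Ω) (X : Fin n → Ω → Matrix (Fin d) (Fin d) 𝕜)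
    (s : Finset (Fin n)) (ω : Ω) : Matrix (Fin d) (Fin d) 𝕜 :=
  descendingProd (fun j => X j ω) s - matrixExpectation μ fun ω => descendingProd (fun j => X j ω) s

section Centred

variable {X : Fin n → Ω → Matrix (Fin d) (Fin d) 𝕜} {L : ℝ}

theorem measurable_descendingProd_comp (hmeas : ∀ j, Measurable (X j)) (s : Finset (Fin n)) :
    Measurable fun ω => descendingProd (fun j => X j ω) s :=
  (measurable_descendingProd s).comp (measurable_pi_lambda _ hmeas)

theorem measurable_centredProd (hmeas : ∀ j, Measurable (X j)) (s : Finset (Fin n)) :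
    Measurable (centredProd μ X s) :=
  (measurable_descendingProd_comp hmeas s).sub_const _

/-- Averaging the block sums over all permutations hits every `k`-subset equally often; the triangle
inequality and convexity of `x ^ q` do the rest. The product order is no obstacle, since
`descendingProd` sorts each image set again. -/
theorem norm_sum_centredProd_pow_le {k : ℕ} {B : ℕ → Finset (Fin n)} (hB : ∀ i, #(B i) = k)
    (hkn : k ≤ n) (m q : ℕ) (ω : Ω) :
    ((m / n.choose k : ℝ) *
        ‖∑ s ∈ powersetCard k (univ : Finset (Fin n)), centredProd μ X s ω‖) ^ q ≤
      ∑ σ : Equiv.Perm (Fin n), (1 / n.factorial : ℝ) *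
        ‖∑ i ∈ range m, centredProd μ X ((B i).map σ.toEmbedding) ω‖ ^ q := by
  obtain ⟨c, hc, hsum⟩ := exists_sum_perm_eq_nsmul_sum (α := Fin n)
    (V := Matrix (Fin d) (Fin d) 𝕜) (k := k) (by simpa using hkn)
  rw [Fintype.card_fin] at hc
  set T := ∑ s ∈ powersetCard k (univ : Finset (Fin n)), centredProd μ X s ω
  have h1 : ∑ σ : Equiv.Perm (Fin n), ∑ i ∈ range m,
      centredProd μ X ((B i).map σ.toEmbedding) ω = (m * c) • T := by
    rw [sum_comm]
    rw [sum_congr rfl fun i _ => hsum (fun s => centredProd μ X s ω) (B i) (hB i), sum_const,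
      card_range, smul_smul]
  have h2 : (m * c : ℝ) * ‖T‖ ≤ ∑ σ : Equiv.Perm (Fin n),
      ‖∑ i ∈ range m, centredProd μ X ((B i).map σ.toEmbedding) ω‖ := by
    refine le_trans (le_of_eq ?_) (norm_sum_le _ _)
    rw [h1, ← Nat.cast_smul_eq_nsmul 𝕜, norm_smul, RCLike.norm_natCast]
    push_cast
    rfl
  have hC : (0 : ℝ) < n.choose k := by exact_mod_cast Nat.choose_pos hkn
  have hc' : (c * n.choose k : ℝ) = n.factorial := by exact_mod_cast hc
  have hn : (0 : ℝ) < n.factorial := by positivity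
  have h3 : (m / n.choose k : ℝ) * ‖T‖ ≤ ∑ σ : Equiv.Perm (Fin n), (1 / n.factorial : ℝ) *
      ‖∑ i ∈ range m, centredProd μ X ((B i).map σ.toEmbedding) ω‖ := by
    rw [← mul_sum, one_div, ← div_eq_inv_mul, le_div_iff₀ hn, ← hc']
    refine le_trans (le_of_eq ?_) h2
    field_simp
  refine (pow_le_pow_left₀ (by positivity) h3 q).trans ?_
  refine Real.pow_arith_mean_le_arith_mean_pow _ _ _ (fun _ _ => by positivity) ?_
    (fun _ _ => norm_nonneg _) q
  rw [sum_const, card_univ, Fintype.card_perm, Fintype.card_fin, nsmul_eq_mul]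
  field_simp

variable [IsProbabilityMeasure μ] [Nonempty (Fin d)]

theorem norm_centredProd_le (hmeas : ∀ j, Measurable (X j)) (hL : ∀ j ω, ‖X j ω‖ ≤ L)
    (hL0 : 0 ≤ L) (s : Finset (Fin n)) (ω : Ω) : ‖centredProd μ X s ω‖ ≤ 2 * L ^ #s := by
  refine (norm_sub_le _ _).trans ?_
  rw [two_mul]
  exact add_le_add (norm_descendingProd_le (fun j => hL j ω) s)
    (norm_matrixExpectation_le (measurable_descendingProd_comp hmeas s)
      (fun ω => norm_descendingProd_le (fun j => hL j ω) s) (by positivity))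

theorem integral_centredProd_apply (hmeas : ∀ j, Measurable (X j)) (hL : ∀ j ω, ‖X j ω‖ ≤ L)
    (s : Finset (Fin n)) (a b : Fin d) : ∫ ω, centredProd μ X s ω a b ∂μ = 0 := by
  have h := integrable_matrix_apply (μ := μ) (measurable_descendingProd_comp hmeas s)
    (fun ω => norm_descendingProd_le (fun j => hL j ω) s) a b
  simp only [centredProd, Matrix.sub_apply]
  rw [integral_sub h (integrable_const _), integral_const]
  simp [matrixExpectation]

theorem degreeTerm_sub_matrixExpectation (hmeas : ∀ j, Measurable (X j))
    (hL : ∀ j ω, ‖X j ω‖ ≤ L) (k : ℕ) (ω : Ω) :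
    degreeTerm (fun j => X j ω) k - matrixExpectation μ (fun ω' => degreeTerm (fun j => X j ω') k) =
      ((1 / (n : 𝕜)) ^ k) • ∑ s ∈ powersetCard k (univ : Finset (Fin n)), centredProd μ X s ω := by
  have h (s : Finset (Fin n)) (a b : Fin d) := integrable_matrix_apply (μ := μ)
    (measurable_descendingProd_comp hmeas s)
    (fun ω => norm_descendingProd_le (fun j => hL j ω) s) a b
  have e : matrixExpectation μ (fun ω' => degreeTerm (fun j => X j ω') k) =
      ((1 / (n : 𝕜)) ^ k) • ∑ s ∈ powersetCard k (univ : Finset (Fin n)),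
        matrixExpectation μ fun ω => descendingProd (fun j => X j ω) s := by
    ext a b
    simp only [matrixExpectation, degreeTerm, Matrix.of_apply, Matrix.smul_apply, Matrix.sum_apply,
      smul_eq_mul]
    rw [integral_const_mul, integral_finsetSum _ fun s _ => h s a b]
  rw [e, degreeTerm, ← smul_sub, ← sum_sub_distrib]
  rfl

theorem integral_norm_block_sum_pow_le (hmeas : ∀ j, Measurable (X j)) (hindep : iIndepFun X μ)
    (hL : ∀ j ω, ‖X j ω‖ ≤ L) (hL0 : 0 ≤ L) {k m : ℕ} {B : ℕ → Finset (Fin n)}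
    (hB : ∀ i, #(B i) = k) (hdisj : ∀ i < m, ∀ j < m, i ≠ j → Disjoint (B i) (B j)) (q : ℕ) :
    ∫ ω, ‖∑ i ∈ range m, centredProd μ X (B i) ω‖ ^ (2 * q) / (2 * q).factorial ∂μ ≤
      d * ((m * ((2 * L ^ k) ^ 2 / 2)) ^ q / q.factorial) := by
  have := integral_norm_sum_pow_le (μ := μ) (Y := fun i => centredProd μ X (B i)) (R := 2 * L ^ k)
    (m := m) (fun i => measurable_centredProd hmeas _)
    (fun i ω => by simpa only [hB] using norm_centredProd_le (μ := μ) hmeas hL hL0 (B i) ω)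
    (fun i a b => integral_centredProd_apply hmeas hL _ a b) (fun l hl => ?_) q
  · simpa using this
  -- Block `l` and the union of the earlier blocks use disjoint sets of coordinates.
  · refine hindep.indepFun_of_dependsOn hmeas (S := B l) (T := (range l).biUnion B)
      (f := fun x => descendingProd x (B l) -
        matrixExpectation μ fun ω => descendingProd (fun j => X j ω) (B l))
      (g := fun x => ∑ i ∈ range l, (descendingProd x (B i) -
        matrixExpectation μ fun ω => descendingProd (fun j => X j ω) (B i))) ?_ ?_ ?_ ?_ ?_
    · rw [disjoint_biUnion_right]
      intro i hi
      rw [mem_range] at hi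
      exact hdisj l hl i (hi.trans hl) hi.ne'
    · exact (measurable_descendingProd _).sub_const _
    · exact Finset.measurable_sum _ fun i _ => (measurable_descendingProd _).sub_const _
    · intro x y h
      simp only
      rw [descendingProd_congr h]
    · intro x y h
      refine sum_congr rfl fun i hi => ?_
      rw [descendingProd_congr fun j hj => h j (mem_coe.2 (mem_biUnion.2 ⟨i, hi, hj⟩))]

/-- Subgaussian tail bound for the sum of the centred products over all `k`-subsets. -/
theorem measureReal_norm_sum_centredProd_le (hmeas : ∀ j, Measurable (X j))
    (hindep : iIndepFun X μ) (hL : ∀ j ω, ‖X j ω‖ ≤ L) (hL0 : 0 < L) {k : ℕ} (hk : 0 < k)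
    (hkn : k ≤ n) {w : ℝ} (hw : 0 ≤ w) :
    μ.real {ω | w < ((n / k : ℕ) / n.choose k : ℝ) *
        ‖∑ s ∈ powersetCard k (univ : Finset (Fin n)), centredProd μ X s ω‖} ≤
      2 * d * Real.exp (-(w ^ 2 / (4 * ((n / k : ℕ) * ((2 * L ^ k) ^ 2 / 2))))) := by
  obtain ⟨B, hB, hdisj⟩ := exists_disjoint_blocks hk hkn
  set m := n / k
  have hm : (0 : ℝ) < m := by exact_mod_cast Nat.div_pos hkn hk
  have hSint (q : ℕ) (σ : Equiv.Perm (Fin n)) : Integrable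
      (fun ω => ‖∑ i ∈ range m, centredProd μ X ((B i).map σ.toEmbedding) ω‖ ^ q) μ := by
    refine .of_bound ((Finset.measurable_sum _ fun i _ =>
      measurable_centredProd hmeas _).norm.pow_const q).aestronglyMeasurable
      ((m * (2 * L ^ k)) ^ q) (.of_forall fun ω => ?_)
    rw [norm_pow, norm_norm]
    gcongr
    refine (norm_sum_le_of_le _ fun i _ => norm_centredProd_le hmeas hL hL0.le _ ω).trans ?_
    simp [hB]
  have hJ := fun q ω => norm_sum_centredProd_pow_le (μ := μ) (X := X) hB hkn m q ω
  have hRint (q : ℕ) : Integrable (fun ω => ∑ σ : Equiv.Perm (Fin n), (1 / n.factorial : ℝ) *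
      ‖∑ i ∈ range m, centredProd μ X ((B i).map σ.toEmbedding) ω‖ ^ q) μ :=
    integrable_finsetSum _ fun σ _ => (hSint q σ).const_mul _
  have hTm : Measurable fun ω => (m / n.choose k : ℝ) *
      ‖∑ s ∈ powersetCard k (univ : Finset (Fin n)), centredProd μ X s ω‖ :=
    (Finset.measurable_sum _ fun s _ => measurable_centredProd hmeas s).norm.const_mul _
  have hTint (q : ℕ) : Integrable (fun ω => ((m / n.choose k : ℝ) *
      ‖∑ s ∈ powersetCard k (univ : Finset (Fin n)), centredProd μ X s ω‖) ^ q) μ := by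
    refine (hRint q).mono' (hTm.pow_const q).aestronglyMeasurable (.of_forall fun ω => ?_)
    rw [Real.norm_of_nonneg (by positivity)]
    exact hJ q ω
  refine measureReal_lt_le_of_even_moments (fun ω => by positivity) (fun q => hTint (2 * q))
    (fun q => ?_) (by positivity) hw
  have hσ (σ : Equiv.Perm (Fin n)) := integral_norm_block_sum_pow_le (μ := μ) hmeas hindep hL
    hL0.le (B := fun i => (B i).map σ.toEmbedding) (fun i => (card_map _).trans (hB i))
    (fun i hi j hj hij => (disjoint_map _).2 (hdisj i hi j hj hij)) q
  calc _ ≤ ∫ ω, (∑ σ : Equiv.Perm (Fin n), (1 / n.factorial : ℝ) *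
        ‖∑ i ∈ range m, centredProd μ X ((B i).map σ.toEmbedding) ω‖ ^ (2 * q)) /
          (2 * q).factorial ∂μ :=
        integral_mono ((hTint _).div_const _) ((hRint _).div_const _) fun ω =>
          div_le_div_of_nonneg_right (hJ _ ω) (by positivity)
    _ = ∑ σ : Equiv.Perm (Fin n), (1 / n.factorial : ℝ) * ∫ ω,
        ‖∑ i ∈ range m, centredProd μ X ((B i).map σ.toEmbedding) ω‖ ^ (2 * q) /
          (2 * q).factorial ∂μ := by
        rw [integral_div, integral_finsetSum _ fun σ _ => (hSint _ σ).const_mul _, sum_div]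
        refine sum_congr rfl fun σ _ => ?_
        rw [integral_const_mul, integral_div, mul_div_assoc]
    _ ≤ ∑ σ : Equiv.Perm (Fin n), (1 / n.factorial : ℝ) *
        (d * ((m * ((2 * L ^ k) ^ 2 / 2)) ^ q / q.factorial)) :=
        sum_le_sum fun σ _ => mul_le_mul_of_nonneg_left (hσ σ) (by positivity)
    _ = _ := by
        rw [sum_const, card_univ, Fintype.card_perm, Fintype.card_fin, nsmul_eq_mul, ← mul_assoc,
          mul_one_div_cancel (by positivity), one_mul]

end Centred

end DescendingProducts

/-! ### Numerical estimates for the deviation level and the conclusion -/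

section Deviation

theorem one_le_exp_div_pow_mul_factorial (r : ℕ) :
    1 ≤ (Real.exp 1 / r) ^ r * r.factorial := by
  rcases Nat.eq_zero_or_pos r with rfl | hr
  · simp
  · have h := Real.pow_div_factorial_le_exp (x := r) (by positivity) r
    have hr' : (0 : ℝ) < r := by exact_mod_cast hr
    rw [div_le_iff₀ (by positivity)] at h
    rw [div_pow, ← Real.exp_nat_mul, mul_one, div_mul_eq_mul_div, le_div_iff₀ (by positivity),
      one_mul]
    exact h

theorem one_le_mul_exp_div_pow {n r : ℕ} (h : r ≤ n) : 1 ≤ (n * Real.exp 1 / r) ^ r := by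
  rcases Nat.eq_zero_or_pos r with rfl | hr
  · simp
  · have hr' : (0 : ℝ) < r := by exact_mod_cast hr
    have h' : (r : ℝ) ≤ n := by exact_mod_cast h
    refine one_le_pow₀ ?_
    rw [le_div_iff₀ hr', one_mul]
    have : 1 ≤ Real.exp 1 := Real.one_le_exp zero_le_one
    nlinarith

theorem gammaLevel_nonneg {n d k : ℕ} (hk : 1 ≤ k) {L δ : ℝ} (hL : 0 ≤ L) :
    0 ≤ gammaLevel n d k L δ := by
  have : (0 : ℝ) ≤ (k : ℝ) - 1 := by
    rw [sub_nonneg]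
    exact_mod_cast hk
  unfold gammaLevel
  positivity

/-- With `r = k - 1`, the term `L r / n` and the factor `(ne/r)^r ≥ 1` inside the logarithm are
discarded. Then `n^k / C(n,k) ≥ k! = k · r!`, and `r!` absorbs `(e/r)^r` because `(e/r)^r r! ≥ 1`.
-/
theorem le_gammaLevel_mul {n d k : ℕ} (hn : 1 ≤ n) (hd : 1 ≤ d) (hk : 1 ≤ k) (hkn : k ≤ n)
    {L δ : ℝ} (hL : 0 < L) (hδ : 0 < δ) :
    4 * k * L ^ k * Real.sqrt (Real.log (2 * d / δ)) / Real.sqrt n ≤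
      gammaLevel n d k L δ * (n ^ k / n.choose k) := by
  obtain ⟨r, rfl⟩ := Nat.exists_eq_add_of_le' hk
  have hn' : (0 : ℝ) < n := by exact_mod_cast hn
  have hC : (0 : ℝ) < n.choose (r + 1) := by exact_mod_cast Nat.choose_pos hkn
  have h1 : ((r + 1).factorial : ℝ) ≤ n ^ (r + 1) / n.choose (r + 1) := by
    rw [le_div_iff₀ hC]
    have := Nat.descFactorial_le_pow n (r + 1)
    rw [Nat.descFactorial_eq_factorial_mul_choose] at this
    exact_mod_cast this
  have e : ((r + 1 : ℕ) : ℝ) - 1 = r := by push_cast; ring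
  have hd' : (0 : ℝ) < d := by exact_mod_cast hd
  have h2 : Real.log (2 * d / δ) ≤
      Real.log (2 * d * (n * Real.exp 1 / r) ^ r / δ) := by
    refine Real.log_le_log (by positivity) ?_
    have : 1 ≤ (n * Real.exp 1 / r) ^ r := one_le_mul_exp_div_pow (by omega)
    exact div_le_div_of_nonneg_right (le_mul_of_one_le_right (by positivity) this) hδ.le
  have h3 : 4 * L ^ (r + 1) * (Real.exp 1 / r) ^ r * Real.sqrt (Real.log (2 * d / δ)) /
      Real.sqrt n ≤ gammaLevel n d (r + 1) L δ := by
    unfold gammaLevel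
    rw [e, Nat.add_sub_cancel]
    calc _ = 2 * (Real.exp 1 * L / r) ^ r *
          (2 * L / Real.sqrt n * Real.sqrt (Real.log (2 * d / δ)) + 0) := by
          rw [mul_div_right_comm (Real.exp 1) L, mul_pow]; ring
      _ ≤ _ := by gcongr; positivity
  calc _ ≤ 4 * ((r + 1 : ℕ) : ℝ) * L ^ (r + 1) * Real.sqrt (Real.log (2 * d / δ)) /
        Real.sqrt n * ((Real.exp 1 / r) ^ r * r.factorial) :=
        le_mul_of_one_le_right (by positivity) (one_le_exp_div_pow_mul_factorial r)
    _ = (4 * L ^ (r + 1) * (Real.exp 1 / r) ^ r * Real.sqrt (Real.log (2 * d / δ)) /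
      Real.sqrt n) * (r + 1).factorial := by rw [Nat.factorial_succ]; push_cast; ring
    _ ≤ _ := mul_le_mul h3 h1 (by positivity) (gammaLevel_nonneg hk hL.le)

theorem two_mul_mul_exp_le {n d k : ℕ} (hn : 1 ≤ n) (hd : 1 ≤ d) (hk : 1 ≤ k) (hkn : k ≤ n)
    {L δ w : ℝ} (hL : 0 < L) (hδ : 0 < δ) (hδ1 : δ ≤ 1)
    (hw : (n / k : ℕ) * (4 * k * L ^ k * Real.sqrt (Real.log (2 * d / δ)) / Real.sqrt n) ≤ w) :
    2 * d * Real.exp (-(w ^ 2 / (4 * ((n / k : ℕ) * ((2 * L ^ k) ^ 2 / 2))))) ≤ δ ^ k := by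
  set m := n / k
  have hm : 1 ≤ m := Nat.div_pos hkn hk
  have hm' : (0 : ℝ) < m := by exact_mod_cast hm
  have hn' : (0 : ℝ) < n := by exact_mod_cast hn
  have hd' : (1 : ℝ) ≤ d := by exact_mod_cast hd
  -- Rounding `n / k` down loses at most a factor 2, which the constant 4 in `w` can afford: the
  -- exponent is at least `2 m k² ℓ / n ≥ k ℓ`.
  have h2mk : (n : ℝ) ≤ 2 * m * k := by
    have h1 : n < m * k + k := Nat.lt_div_mul_add hk
    have h2 := Nat.mul_le_mul_right k hm
    exact_mod_cast (by linarith : n ≤ 2 * m * k)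
  set ℓ := Real.log (2 * d / δ)
  have hℓ : 0 ≤ ℓ := Real.log_nonneg (by rw [le_div_iff₀ hδ]; linarith)
  have hsq : (16 * m ^ 2 * k ^ 2 * (L ^ k) ^ 2 * ℓ / n) ≤ w ^ 2 := by
    refine le_of_eq_of_le ?_ (pow_le_pow_left₀ (by positivity) hw 2)
    rw [mul_pow, div_pow, mul_pow, Real.sq_sqrt hℓ, Real.sq_sqrt hn'.le]
    ring
  have hexp : k * ℓ ≤ w ^ 2 / (4 * (m * ((2 * L ^ k) ^ 2 / 2))) := by
    rw [le_div_iff₀ (by positivity)]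
    refine le_trans ?_ hsq
    rw [le_div_iff₀ hn']
    have : k * ℓ * (4 * (m * ((2 * L ^ k) ^ 2 / 2))) * n =
      (8 * k * m * (L ^ k) ^ 2 * ℓ) * n := by ring
    rw [this]
    calc _ ≤ (8 * k * m * (L ^ k) ^ 2 * ℓ) * (2 * m * k) := by gcongr
      _ = _ := by ring
  have hA : (1 : ℝ) ≤ 2 * d := by linarith
  calc _ ≤ 2 * d * Real.exp (-(k * ℓ)) := by gcongr
    _ = 2 * d * (δ / (2 * d)) ^ k := by
        rw [Real.exp_neg, Real.exp_nat_mul, Real.exp_log (by positivity), ← inv_pow, inv_div]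
    _ = δ ^ k * (2 * d / (2 * d) ^ k) := by rw [div_pow]; ring
    _ ≤ δ ^ k * 1 := by
        gcongr
        exact div_le_one_of_le₀ (le_self_pow₀ hA (by omega)) (by positivity)
    _ = _ := mul_one _

variable {𝕜 : Type*} [RCLike 𝕜] {Ω : Type*} [MeasurableSpace Ω] {μ : Measure Ω}
  [IsProbabilityMeasure μ]

/-- The deviation bound for everywhere bounded matrices. Disjoint blocks of `k` indices, averaged
over permutations, give it without a common mean and without an upper bound on `k`. -/
theorem measureReal_degreeTerm_deviation_le {n d k : ℕ} (hn : 1 ≤ n) (hd : 1 ≤ d) (hk : 1 ≤ k)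
    {L δ : ℝ} (hL : 0 < L) (hδ : 0 < δ) {X : Fin n → Ω → Matrix (Fin d) (Fin d) 𝕜}
    (hmeas : ∀ j, Measurable (X j)) (hindep : iIndepFun X μ) (hbound : ∀ j ω, ‖X j ω‖ ≤ L) :
    μ.real {ω | gammaLevel n d k L δ <
        ‖degreeTerm (fun j => X j ω) k
          - matrixExpectation μ (fun ω' => degreeTerm (fun j => X j ω') k)‖}
      ≤ δ ^ k := by
  have : Nonempty (Fin d) := ⟨⟨0, hd⟩⟩
  have hγ := gammaLevel_nonneg (n := n) (d := d) (δ := δ) hk hL.le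
  rcases le_or_gt 1 δ with hδ1 | hδ1
  · exact measureReal_le_one.trans (one_le_pow₀ hδ1)
  simp only [degreeTerm_sub_matrixExpectation hmeas hbound]
  -- For `k > n` the sum is empty and the deviation is zero.
  rcases lt_or_ge n k with hkn | hkn
  · rw [Finset.powersetCard_eq_empty.2 (by simpa using hkn)]
    simp only [Finset.sum_empty, smul_zero, norm_zero, hγ.not_gt, Set.ofPred_false,
      measureReal_empty]
    positivity
  have hn' : (0 : ℝ) < n := by exact_mod_cast hn
  have hC : (0 : ℝ) < n.choose k := by exact_mod_cast Nat.choose_pos hkn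
  have hm : (0 : ℝ) < (n / k : ℕ) := by exact_mod_cast Nat.div_pos hkn hk
  have hw := mul_le_mul_of_nonneg_left (le_gammaLevel_mul hn hd hk hkn hL hδ) hm.le
  refine le_trans ?_ ((measureReal_norm_sum_centredProd_le hmeas hindep hbound hL hk hkn
    (by positivity)).trans (two_mul_mul_exp_le hn hd hk hkn hL hδ hδ1.le hw))
  refine measureReal_mono fun ω hω => ?_
  simp only [Set.mem_ofPred_eq, norm_smul, norm_pow,
    RCLike.norm_natCast, one_div, inv_pow, norm_inv] at hω ⊢
  rw [← div_eq_inv_mul, lt_div_iff₀ (by positivity)] at hω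
  calc _ = ((n / k : ℕ) / n.choose k : ℝ) * (gammaLevel n d k L δ * n ^ k) := by ring
    _ < _ := by gcongr

theorem measurable_truncation {d : ℕ} (L : ℝ) :
    Measurable fun A : Matrix (Fin d) (Fin d) 𝕜 => if ‖A‖ ≤ L then A else 0 :=
  Measurable.ite (measurableSet_le measurable_norm measurable_const) measurable_id
    measurable_const

end Deviation

theorem mainTheorem2 {𝕜 : Type*} [RCLike 𝕜] {Ω : Type*} [MeasurableSpace Ω]
    (μ : Measure Ω) [IsProbabilityMeasure μ]
    (n d k : ℕ) (hn : 1 ≤ n) (hd : 1 ≤ d) (hk : 1 ≤ k)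
    (L δ : ℝ) (hL : 0 < L) (hδ : 0 < δ)
    (X : Fin n → Ω → Matrix (Fin d) (Fin d) 𝕜) (M : Matrix (Fin d) (Fin d) 𝕜)
    (hmeas : ∀ j, Measurable (X j))
    (hindep : iIndepFun X μ)
    (hmean : ∀ j, matrixExpectation μ (X j) = M)
    (hbound : ∀ j, ∀ᵐ ω ∂μ, ‖X j ω‖ ≤ L)
    (hkn : (k : ℝ) ≤
      (16 * n / (Real.log (d / δ) + Real.log (n * Real.exp 1))) ^ (1 / 3 : ℝ)) :
    μ.real {ω | gammaLevel n d k L δ <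
        ‖degreeTerm (fun j => X j ω) k
          - matrixExpectation μ (fun ω' => degreeTerm (fun j => X j ω') k)‖}
      ≤ δ ^ k := by
  -- Truncating each matrix to zero where its norm exceeds `L` makes the bound hold everywhere. It
  -- preserves independence and changes the degree term only on a null set.
  have hτ := measurable_truncation (𝕜 := 𝕜) (d := d) L
  set τ : Matrix (Fin d) (Fin d) 𝕜 → Matrix (Fin d) (Fin d) 𝕜 := fun A => if ‖A‖ ≤ L then A else 0
  have hτL (A : Matrix (Fin d) (Fin d) 𝕜) : ‖τ A‖ ≤ L := by
    simp only [τ]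
    split_ifs with h
    · exact h
    · simpa using hL.le
  have hae : ∀ᵐ ω ∂μ, degreeTerm (fun j => X j ω) k = degreeTerm (fun j => τ (X j ω)) k := by
    filter_upwards [ae_all_iff.2 hbound] with ω hω
    congr 1
    ext1 j
    simp only [τ, if_pos (hω j)]
  have hE : matrixExpectation μ (fun ω => degreeTerm (fun j => X j ω) k) =
      matrixExpectation μ (fun ω => degreeTerm (fun j => τ (X j ω)) k) := by
    ext a b
    refine integral_congr_ae ?_
    filter_upwards [hae] with ω hω
    rw [hω]
  refine le_of_eq_of_le ?_ (measureReal_degreeTerm_deviation_le (μ := μ) hn hd hk hL hδ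
    (X := fun j ω => τ (X j ω)) (fun j => hτ.comp (hmeas j)) (hindep.comp (fun _ => τ) fun _ => hτ)
    fun j ω => hτL _)
  refine measureReal_congr ?_
  filter_upwards [hae] with ω hω
  refine propext ?_
  show _ < _ ↔ _ < _
  rw [hω, hE]
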